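/- Let $d\ge 5$. Consider the lattice $\mathbb Z^d$ with its nearest-neighbour bonds (unordered pairs $\{x,y\}$ with $\sum_i|x_i-y_i|=1$). For $\gamma>0$, let $\mathbb Q$ be a probability law on environments $\omega=(\omega_b)_b$, indexed by the bonds, under which the conductances $\omega_b$ are independent and identically distributed, $0<\omega_b\le 1$ almost surely, and $$\mathbb Q(\omega_b\le a)\sim a^{\gamma}\qquad (a\downarrow 0),$$ i.e. the ratio of the two sides tends to $1$. For neighbours $x,y$ write $\omega_{xy}=\omega_{yx}=\omega_{\{x,y\}}$, and put $\omega_{xy}=0$ otherwise. Let $\pi_\omega(x)=\sum_y\omega_{xy}$, let $P_\omega(x,y)=\omega_{xy}/\pi_\omega(x)$ be the transition matrix of the random walk among the conductances $\omega$, and let $P^n_\omega(x,y)$ be its $n$-step transition probabilities. Then there is a positive function $\delta(\gamma)$, $\gamma>0$, depending only on $d$ and $\gamma$, namely $\delta(\gamma)=4d^2/\gamma$, such that $\delta(\gamma)\to0$ as $\gamma\to+\infty$ and such that, for every $\gamma>0$ and every law $\mathbb Q$ as above, $\mathbb Q$-almost surely, $$\limsup_{n\to+\infty}\ \sup_{x\in\mathbb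 Z^d}\frac{\log P^n_\omega(0,x)}{\log n}\ \le\ -\frac d2+\delta(\gamma),$$ where $\log 0=-\infty$. -/

import Mathlib

open Filter Topology MeasureTheory ProbabilityTheory Asymptotics
open scoped NNReal ENNReal

/-- The nearest-neighbour graph on `ℤ^d`: `x ∼ y` iff their `ℓ¹`-distance is `1`. -/
def latticeGraph (d : ℕ) : SimpleGraph (Fin d → ℤ) where
  Adj x y := ∑ i, |x i - y i| = 1
  symm := ⟨fun x y h => by simpa only [abs_sub_comm] using h⟩
  loopless := ⟨fun x h => by simp at h⟩

/-- Unordered nearest-neighbour bonds of `ℤ^d`. -/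
abbrev Bond (d : ℕ) : Type := (latticeGraph d).edgeSet

/-- Environments: a nonnegative conductance on every nearest-neighbour bond. The measurable
structure is the product one, generated by the cylinder functions. -/
abbrev Environment (d : ℕ) : Type := Bond d → ℝ≥0

open Classical in
/-- The symmetric conductance `ω_{xy}`, equal to `0` when `x` and `y` are not neighbours. -/
noncomputable def conductance {d : ℕ} (ω : Environment d) (x y : Fin d → ℤ) : ℝ≥0∞ :=
  if h : (latticeGraph d).Adj x y then (ω ⟨s(x, y), h⟩ : ℝ≥0∞) else 0

/-- The reversible measure `π_ω(x) = ∑_y ω_{xy}`. -/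
noncomputable def reversibleMeasure {d : ℕ} (ω : Environment d) (x : Fin d → ℤ) : ℝ≥0∞ :=
  ∑' y, conductance ω x y

/-- The one-step transition probability `P_ω(x, y) = ω_{xy} / π_ω(x)`. -/
noncomputable def transitionProb {d : ℕ} (ω : Environment d) (x y : Fin d → ℤ) : ℝ≥0∞ :=
  conductance ω x y / reversibleMeasure ω x

/-- The heat kernel (`n`-step transition probability) `P^n_ω(x, y)`. -/
noncomputable def heatKernel {d : ℕ} (ω : Environment d) :
    ℕ → (Fin d → ℤ) → (Fin d → ℤ) → ℝ≥0∞
  | 0, x, y => if x = y then 1 else 0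
  | n + 1, x, y => ∑' z, heatKernel ω n x z * transitionProb ω z y

/-- `Q` is the law of i.i.d. conductances with values in `(0, 1]` and with
`Q(ω_b ≤ a) ∼ a^γ` as `a ↓ 0`. -/
structure IsPolynomialTailLaw {d : ℕ} (γ : ℝ) (Q : Measure (Environment d)) : Prop where
  indep : iIndepFun (fun (b : Bond d) (ω : Environment d) => ω b) Q
  identDistrib : ∀ b b' : Bond d,
    IdentDistrib (fun ω : Environment d => ω b) (fun ω : Environment d => ω b') Q Q
  pos : ∀ b : Bond d, ∀ᵐ ω ∂Q, 0 < ω b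
  le_one : ∀ b : Bond d, ∀ᵐ ω ∂Q, ω b ≤ 1
  tail : ∀ b : Bond d,
    (fun a : ℝ => Q.real {ω | (ω b : ℝ) ≤ a}) ~[𝓝[>] 0] (fun a : ℝ => a ^ γ)

/-!
The bound only requires the conductances seen by the walk up to time `n` not to be too small. By
the tail assumption and the Borel-Cantelli lemma, almost surely all bonds touching the box of
radius `n` eventually have conductance larger than `α = n^{-s}`, with `s = (d + 2) / γ`
(`IsPolynomialTailLaw.ae_eventually_lt`). As the walk does not leave that box before time `n`,
the environment may be replaced by one with values in `[α, 1]` everywhere (`heatKernel_congr`),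
and it remains to bound the heat kernel of such an environment with an explicit dependence on `α`.

This is a Nash argument at one fixed scale `r`. Let `f_n = P^n(o, ·) / π` and let `u_n` be its
squared norm in `ℓ²(π)`. One step of the walk dissipates `u_n - u_{n+1} ≥ (α / 2) D(f_n)`, where
`D` is the Dirichlet form of the walk with steps `±2eᵢ` (`heatEnergy_succ_add_le`): the loss is the
variance of `f_n` under one step, and the two neighbours `z ± eᵢ` contribute to it separately for
each `i`. Steps of length two avoid any difficulty with the period of the walk. On the other hand,
comparing a function `f ≥ 0` with its averages over `x + 2 {0, …, r - 1}^d` gives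
`‖f‖₂² ≤ (d r)² D(f) + 2 r^{-d} ‖f‖₁²` (`tsum_sq_le_doubleStepEnergy`). Together these make `u_n`
contract at rate `α / (4 d³ r²)` towards the level `4 d r^{-d} α^{-2}` (`heatEnergy_succ_le`).
By self-adjointness, `P^n(o, x) / π(x)` is the inner product of two such densities at times
about `n / 2`, which bounds the heat kernel uniformly in `x` (`heatKernel_le_of_elliptic`).

Choosing `r = ⌈n^κ⌉` with `κ = 1 / 2 - 2 d / γ` makes the exponential term negligible, and the
level is then smaller than `n^{-d/2 + 4d²/γ}`. This needs `γ > 8 d`; for smaller `γ` the claimed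
exponent is nonnegative and the bound `P^n ≤ 1` suffices.
-/

/-! ### Unit steps and conductances -/

/-- The `2d` unit steps of `ℤ^d`: `inl i` is the step `+eᵢ`, `inr i` is the step `-eᵢ`. -/
def unitStep {d : ℕ} : Fin d ⊕ Fin d → (Fin d → ℤ)
  | Sum.inl i => Pi.single i 1
  | Sum.inr i => -Pi.single i 1

theorem unitStep_injective {d : ℕ} : Function.Injective (unitStep (d := d)) := by
  have h1 : ∀ i j : Fin d, (Pi.single i 1 : Fin d → ℤ) ≠ -Pi.single j 1 := by
    intro i j h
    have := congrFun h i
    by_cases hij : i = j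
    · subst hij; simp at this
    · simp [hij] at this
  have h2 : ∀ i j : Fin d, (Pi.single i 1 : Fin d → ℤ) = Pi.single j 1 → i = j := by
    intro i j h
    by_contra hij
    have := congrFun h i
    simp [hij] at this
  rintro (i | i) (j | j) h
  · rw [h2 i j h]
  · exact absurd h (h1 i j)
  · exact absurd h.symm (h1 j i)
  · rw [h2 i j (neg_injective h)]

theorem latticeGraph_adj_add_unitStep {d : ℕ} (x : Fin d → ℤ) (k : Fin d ⊕ Fin d) :
    (latticeGraph d).Adj x (x + unitStep k) := by
  rcases k with i | i <;>
  simp [latticeGraph, unitStep, Pi.single_apply, apply_ite abs]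

theorem exists_unitStep_of_adj {d : ℕ} {x y : Fin d → ℤ} (h : (latticeGraph d).Adj x y) :
    ∃ k, y = x + unitStep k := by
  have h : ∑ i, |x i - y i| = 1 := h
  obtain ⟨i, hi⟩ : ∃ i, x i - y i ≠ 0 := by
    by_contra! h0
    simp [h0] at h
  have h1 : 1 ≤ |x i - y i| := Int.one_le_abs hi
  rw [← Finset.add_sum_erase _ _ (Finset.mem_univ i)] at h
  have hnn : ∀ j ∈ Finset.univ.erase i, 0 ≤ |x j - y j| := fun j _ => abs_nonneg _
  have h2 := Finset.sum_nonneg hnn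
  have h3 : ∑ j ∈ Finset.univ.erase i, |x j - y j| = 0 := by omega
  have h4 : ∀ j, j ≠ i → x j = y j := by
    intro j hj
    have := (Finset.sum_eq_zero_iff_of_nonneg hnn).1 h3 j (by simp [hj])
    rw [abs_eq_zero] at this
    omega
  have h5 : |x i - y i| = 1 := by omega
  rcases (abs_eq zero_le_one).1 h5 with h6 | h6
  · refine ⟨Sum.inr i, funext fun j => ?_⟩
    by_cases hj : j = i
    · subst hj; simp [unitStep]; omega
    · simp [unitStep, hj, h4 j hj]
  · refine ⟨Sum.inl i, funext fun j => ?_⟩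
    by_cases hj : j = i
    · subst hj; simp [unitStep]; omega
    · simp [unitStep, hj, h4 j hj]

theorem conductance_comm {d : ℕ} (ω : Environment d) (x y : Fin d → ℤ) :
    conductance ω x y = conductance ω y x := by
  unfold conductance
  by_cases h : (latticeGraph d).Adj x y
  · rw [dif_pos h, dif_pos h.symm]
    simp only [Sym2.eq_swap]
  · rw [dif_neg h, dif_neg fun h' => h h'.symm]

theorem conductance_add_unitStep {d : ℕ} (ω : Environment d) (x : Fin d → ℤ)
    (k : Fin d ⊕ Fin d) :
    conductance ω x (x + unitStep k) =
      ω ⟨s(x, x + unitStep k), latticeGraph_adj_add_unitStep x k⟩ :=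
  dif_pos _

theorem tsum_conductance_mul {d : ℕ} (ω : Environment d) (x : Fin d → ℤ)
    (g : (Fin d → ℤ) → ℝ≥0∞) :
    ∑' y, conductance ω x y * g y =
      ∑ k, conductance ω x (x + unitStep k) * g (x + unitStep k) := by
  have hinj : Function.Injective fun k : Fin d ⊕ Fin d => x + unitStep k :=
    fun _ _ h => unitStep_injective (add_left_cancel h)
  rw [← hinj.tsum_eq (f := fun y => conductance ω x y * g y), tsum_fintype]
  intro y hy
  have hc : conductance ω x y ≠ 0 := left_ne_zero_of_mul hy
  have hadj : (latticeGraph d).Adj x y := by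
    by_contra h
    exact hc (dif_neg h)
  obtain ⟨k, rfl⟩ := exists_unitStep_of_adj hadj
  exact ⟨k, rfl⟩

theorem reversibleMeasure_eq_sum {d : ℕ} (ω : Environment d) (x : Fin d → ℤ) :
    reversibleMeasure ω x = ∑ k, conductance ω x (x + unitStep k) := by
  simpa [reversibleMeasure] using tsum_conductance_mul ω x 1

theorem reversibleMeasure_le {d : ℕ} {ω : Environment d} (hω : ∀ b, ω b ≤ 1) (x : Fin d → ℤ) :
    reversibleMeasure ω x ≤ 2 * d := by
  rw [reversibleMeasure_eq_sum]
  calc ∑ k, conductance ω x (x + unitStep k) ≤ ∑ _k : Fin d ⊕ Fin d, 1 := by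
        refine Finset.sum_le_sum fun k _ => ?_
        rw [conductance_add_unitStep]
        exact_mod_cast hω _
    _ = 2 * d := by simp [two_mul]

theorem le_reversibleMeasure {d : ℕ} (hd : d ≠ 0) {ω : Environment d} {α : ℝ≥0}
    (hω : ∀ b, α ≤ ω b) (x : Fin d → ℤ) : (α : ℝ≥0∞) ≤ reversibleMeasure ω x := by
  rw [reversibleMeasure_eq_sum]
  have : NeZero d := ⟨hd⟩
  calc (α : ℝ≥0∞) ≤ conductance ω x (x + unitStep (Sum.inl 0)) := by
        rw [conductance_add_unitStep]
        exact_mod_cast hω _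
    _ ≤ _ := Finset.single_le_sum (f := fun k => conductance ω x (x + unitStep k))
        (fun _ _ => zero_le) (Finset.mem_univ _)

/-! ### Heat kernel densities -/

/-- The density `P^n_ω(o, ·) / π_ω` of the law of the walk at time `n` with respect to the
reversible measure. -/
noncomputable def heatDensity {d : ℕ} (ω : Environment d) (n : ℕ) (o x : Fin d → ℤ) : ℝ≥0∞ :=
  heatKernel ω n o x / reversibleMeasure ω x

theorem heatKernel_succ_eq {d : ℕ} (ω : Environment d) (n : ℕ) (o x : Fin d → ℤ) :
    heatKernel ω (n + 1) o x = ∑' y, conductance ω x y * heatDensity ω n o y := by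
  rw [heatKernel]
  refine tsum_congr fun y => ?_
  rw [transitionProb, heatDensity, conductance_comm ω y x, div_eq_mul_inv, div_eq_mul_inv]
  ring

theorem tsum_heatKernel_le_one {d : ℕ} (ω : Environment d) (n : ℕ) (o : Fin d → ℤ) :
    ∑' x, heatKernel ω n o x ≤ 1 := by
  induction n with
  | zero => simp [heatKernel]
  | succ n ih =>
    simp only [heatKernel]
    rw [ENNReal.tsum_comm]
    refine le_trans (ENNReal.tsum_le_tsum fun z => ?_) ih
    rw [ENNReal.tsum_mul_left]
    refine mul_le_of_le_one_right' ?_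
    simp only [transitionProb, div_eq_mul_inv]
    rw [ENNReal.tsum_mul_right, ← div_eq_mul_inv]
    exact ENNReal.div_self_le_one

theorem heatKernel_le_one {d : ℕ} (ω : Environment d) (n : ℕ) (o x : Fin d → ℤ) :
    heatKernel ω n o x ≤ 1 :=
  (ENNReal.le_tsum x).trans (tsum_heatKernel_le_one ω n o)

/-- Self-adjointness of the transition operator in `ℓ²(π)`. -/
theorem tsum_heatKernel_mul_heatDensity_succ {d : ℕ} (ω : Environment d) (n m : ℕ)
    (o o' : Fin d → ℤ) :
    ∑' z, heatKernel ω (n + 1) o z * heatDensity ω m o' z =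
      ∑' z, heatKernel ω n o z * heatDensity ω (m + 1) o' z := by
  have h : ∀ z, heatKernel ω n o z * heatDensity ω (m + 1) o' z =
      heatDensity ω n o z * heatKernel ω (m + 1) o' z := fun z => by
    simp only [heatDensity, div_eq_mul_inv]; ring
  simp only [h, heatKernel_succ_eq, ← ENNReal.tsum_mul_left, ← ENNReal.tsum_mul_right]
  rw [ENNReal.tsum_comm]
  refine tsum_congr fun y => tsum_congr fun z => ?_
  rw [conductance_comm]
  ring

theorem tsum_heatKernel_mul_heatDensity {d : ℕ} (ω : Environment d) (n m : ℕ)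
    (o o' : Fin d → ℤ) :
    ∑' z, heatKernel ω n o z * heatDensity ω m o' z = heatDensity ω (n + m) o o' := by
  induction m generalizing n with
  | zero =>
    rw [tsum_eq_single o']
    · simp [heatDensity, heatKernel, div_eq_mul_inv]
    · intro z hz
      simp [heatDensity, heatKernel, hz.symm]
  | succ m ih =>
    rw [← tsum_heatKernel_mul_heatDensity_succ, ih, Nat.add_right_comm, Nat.add_assoc]

/-! ### Energy dissipation -/

/-- The Dirichlet form of the walk on `ℤ^d` with the steps `±2eᵢ`, each pair of points at
distance `2eᵢ` being indexed by its midpoint. -/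
noncomputable def doubleStepEnergy {d : ℕ} (f : (Fin d → ℤ) → ℝ) : ℝ≥0∞ :=
  ∑' x, ∑ i : Fin d,
    ENNReal.ofReal ((f (x + unitStep (Sum.inl i)) - f (x + unitStep (Sum.inr i))) ^ 2)

/-- The squared norm of the heat kernel density at time `n` in `ℓ²(π)`. -/
noncomputable def heatEnergy {d : ℕ} (ω : Environment d) (n : ℕ) (o : Fin d → ℤ) : ℝ≥0∞ :=
  ∑' z, heatKernel ω n o z * heatDensity ω n o z

/-- The weighted variance of the values `a` is at least `α / 2` times the sum of the squared
differences over the disjoint pairs `(inl i, inr i)`. -/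
theorem sq_sum_div_add_le_sum_mul_sq {ι : Type*} [Fintype ι] {α : ℝ} (w a : ι ⊕ ι → ℝ)
    (hα : 0 ≤ α) (hw : ∀ k, α ≤ w k) (hW : 0 < ∑ k, w k) :
    (∑ k, w k * a k) * ((∑ k, w k * a k) / ∑ k, w k) +
      α / 2 * ∑ i, (a (Sum.inl i) - a (Sum.inr i)) ^ 2 ≤ ∑ k, w k * a k ^ 2 := by
  set m := (∑ k, w k * a k) / ∑ k, w k with hm
  have hS : ∑ k, w k * a k = m * ∑ k, w k := by
    rw [hm, div_mul_cancel₀ _ hW.ne']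
  have h1 : ∑ k, w k * a k ^ 2 =
      (∑ k, w k * a k) * m + ∑ k, w k * (a k - m) ^ 2 := by
    have : ∀ k, w k * (a k - m) ^ 2 = w k * a k ^ 2 - 2 * m * (w k * a k) + m ^ 2 * w k :=
      fun k => by ring
    simp only [this, Finset.sum_add_distrib, Finset.sum_sub_distrib, ← Finset.mul_sum]
    rw [hS]; ring
  rw [h1]
  gcongr
  rw [Fintype.sum_sum_type, ← Finset.sum_add_distrib, Finset.mul_sum]
  refine Finset.sum_le_sum fun i _ => ?_
  have h2 := mul_le_mul_of_nonneg_right (hw (Sum.inl i)) (sq_nonneg (a (Sum.inl i) - m))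
  have h3 := mul_le_mul_of_nonneg_right (hw (Sum.inr i)) (sq_nonneg (a (Sum.inr i) - m))
  have h4 := mul_nonneg hα (sq_nonneg (a (Sum.inl i) - m + (a (Sum.inr i) - m)))
  nlinarith

theorem heatDensity_ne_top {d : ℕ} (hd : d ≠ 0) {ω : Environment d} {α : ℝ≥0} (hα : 0 < α)
    (hω : ∀ b, α ≤ ω b) (n : ℕ) (o x : Fin d → ℤ) : heatDensity ω n o x ≠ ∞ := by
  refine ENNReal.div_ne_top ((heatKernel_le_one ω n o x).trans_lt ENNReal.one_lt_top).ne ?_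
  exact (lt_of_lt_of_le (by exact_mod_cast hα) (le_reversibleMeasure hd hω x)).ne'

theorem heatKernel_eq_reversibleMeasure_mul {d : ℕ} (hd : d ≠ 0) {ω : Environment d} {α : ℝ≥0}
    (hα : 0 < α) (hω : ∀ b, α ≤ ω b) (hω1 : ∀ b, ω b ≤ 1) (n : ℕ) (o x : Fin d → ℤ) :
    heatKernel ω n o x = reversibleMeasure ω x * heatDensity ω n o x := by
  rw [heatDensity, ENNReal.mul_div_cancel]
  · exact (lt_of_lt_of_le (by exact_mod_cast hα) (le_reversibleMeasure hd hω x)).ne'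
  · exact ((reversibleMeasure_le hω1 x).trans_lt (by finiteness)).ne

theorem heatEnergy_succ_add_le {d : ℕ} (hd : d ≠ 0) {ω : Environment d} {α : ℝ≥0}
    (hα : 0 < α) (hω : ∀ b, α ≤ ω b) (hω1 : ∀ b, ω b ≤ 1) (n : ℕ) (o : Fin d → ℤ) :
    heatEnergy ω (n + 1) o +
      ENNReal.ofReal (α / 2) * doubleStepEnergy (fun x => (heatDensity ω n o x).toReal) ≤
        heatEnergy ω n o := by
  have hd' : NeZero d := ⟨hd⟩
  -- By symmetry of the conductances, `u_n = ∑_y ∑_{z ∼ y} ω_{yz} f_n(z)²`, and for each `y` the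
  -- claim is a variance inequality for the values of `f_n` at the neighbours of `y`.
  have h1 : heatEnergy ω n o =
      ∑' y, ∑ k, conductance ω y (y + unitStep k) * heatDensity ω n o (y + unitStep k) ^ 2 := by
    simp only [heatEnergy, heatKernel_eq_reversibleMeasure_mul hd hα hω hω1, reversibleMeasure,
      mul_assoc, ← sq, ← ENNReal.tsum_mul_right]
    rw [ENNReal.tsum_comm]
    refine tsum_congr fun y => ?_
    simp only [conductance_comm ω _ y]
    exact tsum_conductance_mul ω y fun z => heatDensity ω n o z ^ 2
  rw [h1, heatEnergy, doubleStepEnergy, ← ENNReal.tsum_mul_left, ← ENNReal.tsum_add]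
  refine ENNReal.tsum_le_tsum fun y => ?_
  set w : Fin d ⊕ Fin d → ℝ := fun k => (conductance ω y (y + unitStep k)).toReal with hw
  set a : Fin d ⊕ Fin d → ℝ := fun k => (heatDensity ω n o (y + unitStep k)).toReal with ha
  have hwα : ∀ k, (α : ℝ) ≤ w k := fun k => by
    simp only [hw, conductance_add_unitStep]
    exact_mod_cast hω _
  have hα' : (0 : ℝ) < α := hα
  have hw0 : ∀ k, 0 ≤ w k := fun k => hα'.le.trans (hwα k)
  have ha0 : ∀ k, 0 ≤ a k := fun k => ENNReal.toReal_nonneg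
  have hW : 0 < ∑ k, w k :=
    Finset.sum_pos (fun k _ => hα'.trans_le (hwα k)) ⟨Sum.inl 0, Finset.mem_univ _⟩
  have hwe : ∀ k, conductance ω y (y + unitStep k) = ENNReal.ofReal (w k) := fun k => by
    simp only [hw, conductance_add_unitStep, ENNReal.coe_toReal, ENNReal.ofReal_coe_nnreal]
  have hae : ∀ k, heatDensity ω n o (y + unitStep k) = ENNReal.ofReal (a k) := fun k =>
    (ENNReal.ofReal_toReal (heatDensity_ne_top hd hα hω n o _)).symm
  have hk : heatKernel ω (n + 1) o y = ENNReal.ofReal (∑ k, w k * a k) := by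
    rw [heatKernel_succ_eq, tsum_conductance_mul,
      ENNReal.ofReal_sum_of_nonneg fun k _ => mul_nonneg (hw0 k) (ha0 k)]
    exact Finset.sum_congr rfl fun k _ => by rw [hwe, hae, ENNReal.ofReal_mul (hw0 k)]
  have hπ : reversibleMeasure ω y = ENNReal.ofReal (∑ k, w k) := by
    rw [reversibleMeasure_eq_sum, ENNReal.ofReal_sum_of_nonneg fun k _ => hw0 k]
    exact Finset.sum_congr rfl fun k _ => hwe k
  have hS0 : 0 ≤ ∑ k, w k * a k := Finset.sum_nonneg fun k _ => mul_nonneg (hw0 k) (ha0 k)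
  rw [heatDensity, hk, hπ, ← ENNReal.ofReal_div_of_pos hW, ← ENNReal.ofReal_mul hS0,
    ← ENNReal.ofReal_sum_of_nonneg fun i _ => sq_nonneg _,
    ← ENNReal.ofReal_mul (by positivity), ← ENNReal.ofReal_add (by positivity)
      (mul_nonneg (by positivity) (Finset.sum_nonneg fun i _ => sq_nonneg _))]
  have hR : ∑ k, conductance ω y (y + unitStep k) * heatDensity ω n o (y + unitStep k) ^ 2 =
      ENNReal.ofReal (∑ k, w k * a k ^ 2) := by
    rw [ENNReal.ofReal_sum_of_nonneg fun k _ => mul_nonneg (hw0 k) (sq_nonneg _)]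
    exact Finset.sum_congr rfl fun k _ => by
      rw [hwe, hae, ENNReal.ofReal_mul (hw0 k), ENNReal.ofReal_pow (ha0 k)]
  rw [hR]
  exact ENNReal.ofReal_le_ofReal (sq_sum_div_add_le_sum_mul_sq w a hα'.le hwα hW)

/-! ### A Nash inequality at a fixed scale -/

/-- The `ℓ²`-norm of the increment of `f` under the translation by `v`. -/
noncomputable def incrementNorm {d : ℕ} (f : (Fin d → ℤ) → ℝ) (v : Fin d → ℤ) : ℝ≥0∞ :=
  eLpNorm (fun x => f (x + v) - f x) 2 Measure.count

theorem incrementNorm_sq {d : ℕ} (f : (Fin d → ℤ) → ℝ) (v : Fin d → ℤ) :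
    incrementNorm f v ^ 2 = ∑' x, ENNReal.ofReal ((f (x + v) - f x) ^ 2) := by
  have h := eLpNorm_nnreal_pow_eq_lintegral (μ := Measure.count)
    (f := fun x => f (x + v) - f x) (p := 2) two_ne_zero
  rw [lintegral_count] at h
  simp only [NNReal.coe_ofNat, ENNReal.rpow_ofNat, ENNReal.coe_ofNat] at h
  rw [incrementNorm, h]
  refine tsum_congr fun x => ?_
  rw [Real.enorm_eq_ofReal_abs, ← ENNReal.ofReal_pow (abs_nonneg _), sq_abs]

theorem incrementNorm_add_le {d : ℕ} (f : (Fin d → ℤ) → ℝ) (v w : Fin d → ℤ) :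
    incrementNorm f (v + w) ≤ incrementNorm f v + incrementNorm f w := by
  have h1 : incrementNorm f w =
      eLpNorm ((fun x => f (x + w) - f x) ∘ fun x => x + v) 2 Measure.count :=
    (eLpNorm_comp_measurePreserving .of_discrete
      (measurePreserving_add_right Measure.count v)).symm
  rw [h1, incrementNorm, incrementNorm]
  refine le_of_eq_of_le (congrArg (fun g => eLpNorm g 2 Measure.count) ?_)
    (eLpNorm_add_le .of_discrete .of_discrete one_le_two)
  funext x
  simp [add_assoc]

theorem incrementNorm_two_mul_single_sq_le {d : ℕ} (f : (Fin d → ℤ) → ℝ) (i : Fin d) :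
    incrementNorm f (Pi.single i 2) ^ 2 ≤ doubleStepEnergy f := by
  rw [incrementNorm_sq, doubleStepEnergy,
    ← (Equiv.addRight (unitStep (Sum.inr i) : Fin d → ℤ)).tsum_eq]
  refine ENNReal.tsum_le_tsum fun x => ?_
  have h : x + unitStep (Sum.inr i) + Pi.single i 2 = x + unitStep (Sum.inl i) := by
    have : (Pi.single i 2 : Fin d → ℤ) = Pi.single i 1 + Pi.single i 1 := by
      rw [← Pi.single_add]; rfl
    simp only [unitStep, this]; abel
  simp only [Equiv.coe_addRight, h]
  exact Finset.single_le_sum (f := fun i => ENNReal.ofReal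
    ((f (x + unitStep (Sum.inl i)) - f (x + unitStep (Sum.inr i))) ^ 2))
    (fun _ _ => zero_le) (Finset.mem_univ i)

theorem incrementNorm_sq_le {d r : ℕ} (f : (Fin d → ℤ) → ℝ) (v : Fin d → Fin r) :
    incrementNorm f (fun i => 2 * ((v i : ℕ) : ℤ)) ^ 2 ≤ (d * r) ^ 2 * doubleStepEnergy f := by
  set D := doubleStepEnergy f ^ (1 / 2 : ℝ) with hD
  have hDsq : D ^ 2 = doubleStepEnergy f := by
    rw [hD, ← ENNReal.rpow_natCast, ← ENNReal.rpow_mul]; norm_num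
  have h0 : incrementNorm f 0 ≤ 0 := by simp [incrementNorm]
  have h1 : ∀ i, incrementNorm f (Pi.single i 2) ≤ D := fun i => by
    rw [← ENNReal.pow_le_pow_left_iff two_ne_zero, hDsq]
    exact incrementNorm_two_mul_single_sq_le f i
  have hsum : (fun i => 2 * ((v i : ℕ) : ℤ)) =
      ∑ i : Fin d, ∑ _j ∈ Finset.range (v i), (Pi.single i 2 : Fin d → ℤ) := by
    funext j
    simp [Finset.sum_apply, Pi.single_apply, mul_comm]
  have h2 : incrementNorm f (fun i => 2 * ((v i : ℕ) : ℤ)) ≤ d * r * D := by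
    rw [hsum]
    calc _ ≤ ∑ i : Fin d, ∑ _j ∈ Finset.range (v i), D := by
          refine (Finset.le_sum_of_subadditive _ h0 (incrementNorm_add_le f) _ _).trans ?_
          refine Finset.sum_le_sum fun i _ => ?_
          refine (Finset.le_sum_of_subadditive _ h0 (incrementNorm_add_le f) _ _).trans ?_
          exact Finset.sum_le_sum fun _ _ => h1 i
      _ ≤ ∑ i : Fin d, r * D := by
          refine Finset.sum_le_sum fun i _ => ?_
          rw [Finset.sum_const, Finset.card_range, nsmul_eq_mul]
          gcongr
          exact (v i).2.le
      _ = d * r * D := by simp [mul_assoc]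
  calc _ ≤ (d * r * D) ^ 2 := by gcongr
    _ = _ := by rw [mul_pow, hDsq]

/-- A Nash inequality at scale `r`: compare `f` with its averages over the boxes
`x + 2 {0, …, r - 1}^d`. -/
theorem tsum_sq_le_doubleStepEnergy {d r : ℕ} (f : (Fin d → ℤ) → ℝ) (hf : ∀ x, 0 ≤ f x) :
    (r : ℝ≥0∞) ^ d * ∑' x, ENNReal.ofReal (f x ^ 2) ≤
      (r : ℝ≥0∞) ^ d * ((d * r) ^ 2 * doubleStepEnergy f) +
        2 * (∑' x, ENNReal.ofReal (f x)) ^ 2 := by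
  have hcard : ∀ c : ℝ≥0∞, (r : ℝ≥0∞) ^ d * c = ∑ _v : Fin d → Fin r, c := by
    intro c; simp
  let t : (Fin d → Fin r) → Fin d → ℤ := fun v i => 2 * ((v i : ℕ) : ℤ)
  have ht : Function.Injective t := by
    intro v w h
    funext i
    have := congrFun h i
    simp only [t] at this
    exact Fin.ext (by omega)
  have h1 : ∀ v, ∑' x, ENNReal.ofReal (f x ^ 2) ≤
      (d * r) ^ 2 * doubleStepEnergy f +
        2 * ∑' x, ENNReal.ofReal (f x) * ENNReal.ofReal (f (x + t v)) := by
    intro v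
    refine le_trans ?_ (add_le_add_left (incrementNorm_sq_le f v) _)
    rw [incrementNorm_sq, ← ENNReal.tsum_mul_left, ← ENNReal.tsum_add]
    refine ENNReal.tsum_le_tsum fun x => ?_
    rw [← ENNReal.ofReal_mul (hf x), ← ENNReal.ofReal_ofNat 2, ← ENNReal.ofReal_mul zero_le_two,
      ← ENNReal.ofReal_add (sq_nonneg _) (mul_nonneg zero_le_two (mul_nonneg (hf _) (hf _)))]
    refine ENNReal.ofReal_le_ofReal ?_
    -- This is `a² ≤ (a - b)² + 2ab`.
    nlinarith [sq_nonneg (f (x + t v))]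
  calc _ ≤ ∑ v : Fin d → Fin r, ((d * r) ^ 2 * doubleStepEnergy f +
        2 * ∑' x, ENNReal.ofReal (f x) * ENNReal.ofReal (f (x + t v))) := by
        rw [hcard]
        exact Finset.sum_le_sum fun v _ => h1 v
    _ = (r : ℝ≥0∞) ^ d * ((d * r) ^ 2 * doubleStepEnergy f) +
        2 * ∑' x, ENNReal.ofReal (f x) * ∑ v, ENNReal.ofReal (f (x + t v)) := by
        rw [Finset.sum_add_distrib, ← hcard, ← Finset.mul_sum]
        rw [← Summable.tsum_finsetSum fun _ _ => ENNReal.summable]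
        simp only [Finset.mul_sum]
    _ ≤ _ := by
        gcongr
        rw [sq, ← ENNReal.tsum_mul_right]
        refine ENNReal.tsum_le_tsum fun x => ?_
        gcongr
        rw [← tsum_fintype (L := .unconditional _)]
        exact ENNReal.tsum_comp_le_tsum_of_injective
          (f := fun v => x + t v) (fun v w h => ht (add_left_cancel h)) _

/-! ### Heat kernel bound in a uniformly elliptic environment -/

theorem heatEnergy_zero_le {d : ℕ} (hd : d ≠ 0) {ω : Environment d} {α : ℝ≥0}
    (hω : ∀ b, α ≤ ω b) (o : Fin d → ℤ) : heatEnergy ω 0 o ≤ (α : ℝ≥0∞)⁻¹ := by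
  rw [heatEnergy, tsum_heatKernel_mul_heatDensity, heatDensity]
  simpa [heatKernel] using le_reversibleMeasure hd hω o

theorem heatEnergy_antitone {d : ℕ} (hd : d ≠ 0) {ω : Environment d} {α : ℝ≥0}
    (hα : 0 < α) (hω : ∀ b, α ≤ ω b) (hω1 : ∀ b, ω b ≤ 1) (o : Fin d → ℤ) :
    Antitone fun n => heatEnergy ω n o :=
  antitone_nat_of_succ_le fun n =>
    le_self_add.trans (heatEnergy_succ_add_le hd hα hω hω1 n o)

theorem heatEnergy_ne_top {d : ℕ} (hd : d ≠ 0) {ω : Environment d} {α : ℝ≥0}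
    (hα : 0 < α) (hω : ∀ b, α ≤ ω b) (hω1 : ∀ b, ω b ≤ 1) (n : ℕ) (o : Fin d → ℤ) :
    heatEnergy ω n o ≠ ∞ :=
  ne_top_of_le_ne_top (ENNReal.inv_ne_top.2 (by exact_mod_cast hα.ne'))
    ((heatEnergy_antitone hd hα hω hω1 o (Nat.zero_le n)).trans (heatEnergy_zero_le hd hω o))

/-- The Nash inequality at scale `r` for the heat kernel density, whose `ℓ¹`-norm for the counting
measure is at most `α⁻¹`. -/
theorem pow_mul_heatEnergy_le {d r : ℕ} (hd : d ≠ 0) {ω : Environment d} {α : ℝ≥0}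
    (hα : 0 < α) (hω : ∀ b, α ≤ ω b) (hω1 : ∀ b, ω b ≤ 1) (n : ℕ) (o : Fin d → ℤ) :
    (r : ℝ≥0∞) ^ d * heatEnergy ω n o ≤
      2 * d * ((r : ℝ≥0∞) ^ d * ((d * r) ^ 2 *
        doubleStepEnergy (fun x => (heatDensity ω n o x).toReal)) + 2 * (α : ℝ≥0∞)⁻¹ ^ 2) := by
  have hα0 : (α : ℝ≥0∞) ≠ 0 := by exact_mod_cast hα.ne'
  have hfin := heatDensity_ne_top hd hα hω n o
  have h1 : heatEnergy ω n o ≤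
      2 * d * ∑' x, ENNReal.ofReal ((heatDensity ω n o x).toReal ^ 2) := by
    rw [heatEnergy, ← ENNReal.tsum_mul_left]
    refine ENNReal.tsum_le_tsum fun x => ?_
    rw [ENNReal.ofReal_pow ENNReal.toReal_nonneg, ENNReal.ofReal_toReal (hfin x),
      heatKernel_eq_reversibleMeasure_mul hd hα hω hω1, mul_assoc, ← sq]
    gcongr
    exact reversibleMeasure_le hω1 x
  have h2 : ∑' x, ENNReal.ofReal (heatDensity ω n o x).toReal ≤ (α : ℝ≥0∞)⁻¹ := by
    calc _ ≤ ∑' x, (α : ℝ≥0∞)⁻¹ * heatKernel ω n o x := by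
          refine ENNReal.tsum_le_tsum fun x => ?_
          rw [ENNReal.ofReal_toReal (hfin x), heatDensity, div_eq_mul_inv, mul_comm]
          gcongr
          exact le_reversibleMeasure hd hω x
      _ ≤ (α : ℝ≥0∞)⁻¹ := by
          rw [ENNReal.tsum_mul_left]
          exact mul_le_of_le_one_right' (tsum_heatKernel_le_one ω n o)
  calc _ ≤ (r : ℝ≥0∞) ^ d *
        (2 * d * ∑' x, ENNReal.ofReal ((heatDensity ω n o x).toReal ^ 2)) := by gcongr
    _ = 2 * d * ((r : ℝ≥0∞) ^ d *
        ∑' x, ENNReal.ofReal ((heatDensity ω n o x).toReal ^ 2)) := by ring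
    _ ≤ 2 * d * ((r : ℝ≥0∞) ^ d * ((d * r) ^ 2 *
          doubleStepEnergy (fun x => (heatDensity ω n o x).toReal)) +
        2 * (∑' x, ENNReal.ofReal (heatDensity ω n o x).toReal) ^ 2) := by
        gcongr
        exact tsum_sq_le_doubleStepEnergy _ fun x => ENNReal.toReal_nonneg
    _ ≤ _ := by gcongr

/-- The energy contracts geometrically towards the level `4 d r^{-d} α^{-2}`. -/
theorem heatEnergy_succ_le {d r : ℕ} (hd : d ≠ 0) (hr : r ≠ 0) {ω : Environment d} {α : ℝ≥0}
    (hα : 0 < α) (hω : ∀ b, α ≤ ω b) (hω1 : ∀ b, ω b ≤ 1) (n : ℕ) (o : Fin d → ℤ) :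
    (heatEnergy ω (n + 1) o).toReal - 4 * d / (r ^ d * α ^ 2) ≤
      (1 - α / (4 * d ^ 3 * r ^ 2)) *
        ((heatEnergy ω n o).toReal - 4 * d / (r ^ d * α ^ 2)) := by
  have hα' : (0 : ℝ) < α := hα
  have hd' : (0 : ℝ) < d := by positivity
  have hr' : (0 : ℝ) < r := by positivity
  have hu := heatEnergy_ne_top hd hα hω hω1 n o
  have h1 := heatEnergy_succ_add_le hd hα hω hω1 n o
  have h2 := pow_mul_heatEnergy_le (r := r) hd hα hω hω1 n o
  set D := doubleStepEnergy (fun x => (heatDensity ω n o x).toReal)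
  have hD : D ≠ ∞ := by
    intro h
    rw [h, ENNReal.mul_top (by simpa using hα), add_top] at h1
    exact hu (top_le_iff.1 h1)
  have hαi : (α : ℝ≥0∞)⁻¹ ≠ ∞ := ENNReal.inv_ne_top.2 (by exact_mod_cast hα.ne')
  have h1' := ENNReal.toReal_mono hu h1
  rw [ENNReal.toReal_add (heatEnergy_ne_top hd hα hω hω1 _ o) (by finiteness),
    ENNReal.toReal_mul, ENNReal.toReal_ofReal (by positivity)] at h1'
  have h2' := ENNReal.toReal_mono (by finiteness) h2
  rw [ENNReal.toReal_mul, ENNReal.toReal_mul, ENNReal.toReal_add (by finiteness) (by finiteness)]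
    at h2'
  simp only [ENNReal.toReal_mul, ENNReal.toReal_pow, ENNReal.toReal_natCast, ENNReal.toReal_inv,
    ENNReal.toReal_ofNat, ENNReal.coe_toReal] at h2'
  set u := (heatEnergy ω n o).toReal
  set u' := (heatEnergy ω (n + 1) o).toReal
  set E := D.toReal
  set A : ℝ := 4 * d / (r ^ d * α ^ 2) with hA
  set β : ℝ := α / (4 * d ^ 3 * r ^ 2) with hβ
  have hβ0 : 0 < β := by positivity
  have h3 : u ≤ 2 * d * (d * r) ^ 2 * E + A := by
    have hp : (0 : ℝ) < r ^ d := by positivity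
    rw [← mul_le_mul_iff_right₀ hp]
    refine h2'.trans (le_of_eq ?_)
    rw [hA]; field_simp; ring
  have h4 : β * (u - A) ≤ α / 2 * E := by
    calc β * (u - A) ≤ β * (2 * d * (d * r) ^ 2 * E) := by gcongr; linarith
      _ = α / 2 * E := by rw [hβ]; field_simp; ring
  linarith

theorem contractionRate_le_one {d r : ℕ} (hd : d ≠ 0) (hr : r ≠ 0) {α : ℝ≥0} (hα1 : α ≤ 1) :
    (α : ℝ) / (4 * d ^ 3 * r ^ 2) ≤ 1 := by
  have h1 : (1 : ℝ) ≤ d := by exact_mod_cast Nat.one_le_iff_ne_zero.2 hd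
  have h2 : (1 : ℝ) ≤ r := by exact_mod_cast Nat.one_le_iff_ne_zero.2 hr
  refine div_le_one_of_le₀ ?_ (by positivity)
  calc (α : ℝ) ≤ 1 := hα1
    _ ≤ 4 * 1 ^ 3 * 1 ^ 2 := by norm_num
    _ ≤ _ := by gcongr

theorem heatEnergy_toReal_le {d r : ℕ} (hd : d ≠ 0) (hr : r ≠ 0) {ω : Environment d} {α : ℝ≥0}
    (hα : 0 < α) (hα1 : α ≤ 1) (hω : ∀ b, α ≤ ω b) (hω1 : ∀ b, ω b ≤ 1) (n : ℕ)
    (o : Fin d → ℤ) :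
    (heatEnergy ω n o).toReal ≤
      4 * d / (r ^ d * α ^ 2) + (1 - α / (4 * d ^ 3 * r ^ 2)) ^ n * (α : ℝ)⁻¹ := by
  have hα' : (0 : ℝ) < α := hα
  have hβ := sub_nonneg.2 (contractionRate_le_one hd hr hα1)
  have hA : (0 : ℝ) ≤ 4 * d / (r ^ d * α ^ 2) := by positivity
  rw [← sub_le_iff_le_add']
  induction n with
  | zero =>
    have h := ENNReal.toReal_mono (ENNReal.inv_ne_top.2 (by exact_mod_cast hα.ne'))
      (heatEnergy_zero_le hd hω o)
    rw [ENNReal.toReal_inv, ENNReal.coe_toReal] at h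
    rw [pow_zero, one_mul]
    linarith
  | succ n ih =>
    refine (heatEnergy_succ_le hd hr hα hω hω1 n o).trans ?_
    exact (mul_le_mul_of_nonneg_left ih hβ).trans_eq (by ring)

theorem heatKernel_le_of_elliptic {d r : ℕ} (hd : d ≠ 0) (hr : r ≠ 0) {ω : Environment d}
    {α : ℝ≥0} (hα : 0 < α) (hα1 : α ≤ 1) (hω : ∀ b, α ≤ ω b) (hω1 : ∀ b, ω b ≤ 1) (n : ℕ)
    (o x : Fin d → ℤ) :
    heatKernel ω n o x ≤ ENNReal.ofReal (4 * d *
      (4 * d / (r ^ d * α ^ 2) + Real.exp (-(α / (4 * d ^ 3 * r ^ 2)) * (n / 2 : ℕ)) / α)) := by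
  set B : ℝ := 4 * d / (r ^ d * α ^ 2) +
    Real.exp (-(α / (4 * d ^ 3 * r ^ 2)) * (n / 2 : ℕ)) / α with hB
  have hu : ∀ y, heatEnergy ω (n / 2) y ≤ ENNReal.ofReal B := by
    intro y
    rw [← ENNReal.ofReal_toReal (heatEnergy_ne_top hd hα hω hω1 (n / 2) y)]
    refine ENNReal.ofReal_le_ofReal ((heatEnergy_toReal_le hd hr hα hα1 hω hω1 _ y).trans ?_)
    rw [hB, div_eq_mul_inv (Real.exp _), mul_comm (-_) (_ : ℝ), Real.exp_nat_mul]
    gcongr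
    · exact sub_nonneg.2 (contractionRate_le_one hd hr hα1)
    · exact Real.one_sub_le_exp_neg _
  -- A crude substitute for the Cauchy-Schwarz inequality: both energies have the same bound.
  have hmax : ∀ a b : ℝ≥0∞, a * b ≤ a * a + b * b := fun a b => by
    rcases le_total a b with h | h
    · exact le_add_left (by gcongr)
    · exact le_add_right (by gcongr)
  have hdens : heatDensity ω n o x ≤ ENNReal.ofReal B + ENNReal.ofReal B := by
    calc heatDensity ω n o x
        = ∑' z, heatKernel ω (n / 2) o z * heatDensity ω (n - n / 2) x z := by
          rw [tsum_heatKernel_mul_heatDensity]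
          congr 1
          omega
      _ ≤ heatEnergy ω (n / 2) o + heatEnergy ω (n - n / 2) x := by
          rw [heatEnergy, heatEnergy, ← ENNReal.tsum_add]
          refine ENNReal.tsum_le_tsum fun z => ?_
          simp only [heatKernel_eq_reversibleMeasure_mul hd hα hω hω1, mul_assoc, ← mul_add]
          gcongr
          exact hmax _ _
      _ ≤ _ := add_le_add (hu o)
          ((heatEnergy_antitone hd hα hω hω1 x (by omega : n / 2 ≤ n - n / 2)).trans (hu x))
  have hB0 : 0 ≤ B := by positivity
  calc heatKernel ω n o x ≤ 2 * d * (ENNReal.ofReal B + ENNReal.ofReal B) := by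
        rw [heatKernel_eq_reversibleMeasure_mul hd hα hω hω1]
        gcongr
        exact reversibleMeasure_le hω1 x
    _ = ENNReal.ofReal (4 * d * B) := by
        rw [ENNReal.ofReal_mul (by positivity), ENNReal.ofReal_mul (by norm_num),
          ENNReal.ofReal_natCast, ENNReal.ofReal_ofNat]
        ring

/-! ### Locality of the heat kernel -/

/-- The bond joining `z` to its neighbour `z + unitStep k`. -/
def bondAt {d : ℕ} (z : Fin d → ℤ) (k : Fin d ⊕ Fin d) : Bond d :=
  ⟨s(z, z + unitStep k), latticeGraph_adj_add_unitStep z k⟩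

theorem abs_unitStep_apply_le {d : ℕ} (k : Fin d ⊕ Fin d) (i : Fin d) :
    |unitStep k i| ≤ 1 := by
  rcases k with j | j <;> by_cases h : i = j <;> simp [unitStep, h]

theorem abs_sub_le_of_heatKernel_ne_zero {d : ℕ} (ω : Environment d) {n : ℕ}
    {o x : Fin d → ℤ} (h : heatKernel ω n o x ≠ 0) (i : Fin d) : |x i - o i| ≤ n := by
  induction n generalizing x with
  | zero =>
    have : o = x := by
      by_contra hne
      simp [heatKernel, hne] at h
    simp [this]
  | succ n ih =>
    rw [heatKernel, Ne, ENNReal.tsum_eq_zero, not_forall] at h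
    obtain ⟨z, hz⟩ := h
    have hzo := ih (left_ne_zero_of_mul hz)
    have hadj : (latticeGraph d).Adj z x := by
      by_contra hadj
      exact hz (by simp [transitionProb, conductance, hadj])
    obtain ⟨k, rfl⟩ := exists_unitStep_of_adj hadj
    have hk := abs_unitStep_apply_le k i
    rw [abs_le] at *
    push_cast
    simp only [Pi.add_apply]
    omega

theorem transitionProb_congr {d : ℕ} {ω ω' : Environment d} {z : Fin d → ℤ}
    (h : ∀ k, ω (bondAt z k) = ω' (bondAt z k)) (y : Fin d → ℤ) :
    transitionProb ω z y = transitionProb ω' z y := by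
  have hc : ∀ y, conductance ω z y = conductance ω' z y := by
    intro y
    by_cases hadj : (latticeGraph d).Adj z y
    · obtain ⟨k, rfl⟩ := exists_unitStep_of_adj hadj
      rw [conductance_add_unitStep, conductance_add_unitStep]
      exact congrArg _ (h k)
    · simp [conductance, hadj]
  simp [transitionProb, reversibleMeasure, hc]

/-- Up to time `N`, the walk only sees the bonds touching the box of radius `N`. -/
theorem heatKernel_congr {d N : ℕ} {ω ω' : Environment d} {o : Fin d → ℤ}
    (h : ∀ z k, (∀ i, |z i - o i| ≤ N) → ω (bondAt z k) = ω' (bondAt z k)) {n : ℕ} (hn : n ≤ N)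
    (x : Fin d → ℤ) : heatKernel ω n o x = heatKernel ω' n o x := by
  induction n generalizing x with
  | zero => rfl
  | succ n ih =>
    rw [heatKernel, heatKernel]
    refine tsum_congr fun z => ?_
    rw [← ih (by omega)]
    by_cases hz : heatKernel ω n o z = 0
    · simp [hz]
    · rw [transitionProb_congr fun k => h z k fun i =>
        (abs_sub_le_of_heatKernel_ne_zero ω hz i).trans (by exact_mod_cast (by omega : n ≤ N))]

/-! ### The smallest conductance in a box -/

/-- The tail bound holds for small `a` uniformly in the bond, the laws being identical. -/
theorem IsPolynomialTailLaw.measure_le_le {d : ℕ} {γ : ℝ} {Q : Measure (Environment d)}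
    [IsProbabilityMeasure Q] (hQ : IsPolynomialTailLaw γ Q) :
    ∀ᶠ a in 𝓝[>] (0 : ℝ), ∀ b : Bond d,
      Q {ω | (ω b : ℝ) ≤ a} ≤ ENNReal.ofReal (2 * a ^ γ) := by
  rcases isEmpty_or_nonempty (Bond d) with he | ⟨⟨b₀⟩⟩
  · exact Eventually.of_forall fun a b => he.elim b
  have h := (hQ.tail b₀).isLittleO.def (c := 1) one_pos
  filter_upwards [h, self_mem_nhdsWithin] with a ha ha0 b
  have hb : Q {ω | (ω b : ℝ) ≤ a} = Q {ω | (ω b₀ : ℝ) ≤ a} :=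
    (hQ.identDistrib b b₀).measure_mem_eq (s := {t : ℝ≥0 | (t : ℝ) ≤ a})
      (measurableSet_le measurable_subtype_coe measurable_const)
  rw [hb, ← ENNReal.ofReal_toReal (measure_ne_top Q _)]
  refine ENNReal.ofReal_le_ofReal ?_
  have hpow : 0 < a ^ γ := Real.rpow_pos_of_pos ha0 γ
  simp only [Pi.sub_apply, Real.norm_eq_abs, one_mul, abs_of_pos hpow] at ha
  have := (abs_le.1 ha).2
  simp only [Measure.real] at this
  linarith

/-- Almost surely, the conductances of the bonds touching the box of radius `n` are eventually
larger than `n^{-s}`, provided that `s γ ≥ d + 2`. -/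
theorem IsPolynomialTailLaw.ae_eventually_lt {d : ℕ} {γ : ℝ} {Q : Measure (Environment d)}
    [IsProbabilityMeasure Q] (hQ : IsPolynomialTailLaw γ Q) {s : ℝ} (hs : 0 < s)
    (hsγ : d + 2 ≤ s * γ) :
    ∀ᵐ ω ∂Q, ∀ᶠ n : ℕ in atTop, ∀ z k, (∀ i, |z i| ≤ (n : ℤ)) →
      (n : ℝ) ^ (-s) < ω (bondAt z k) := by
  have hlim : Tendsto (fun n : ℕ => (n : ℝ) ^ (-s)) atTop (𝓝[>] 0) := by
    refine tendsto_nhdsWithin_iff.2 ⟨(tendsto_rpow_neg_atTop hs).comp tendsto_natCast_atTop_atTop,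
      ?_⟩
    filter_upwards [eventually_gt_atTop 0] with n hn
    exact Real.rpow_pos_of_pos (by exact_mod_cast hn) _
  obtain ⟨N, hN⟩ := eventually_atTop.1 ((hlim.eventually hQ.measure_le_le).and
    (eventually_ge_atTop 1))
  let bad : ℕ → Set (Environment d) := fun n => {ω | N ≤ n ∧ ∃ z k, (∀ i, |z i| ≤ (n : ℤ)) ∧
    (ω (bondAt z k) : ℝ) ≤ (n : ℝ) ^ (-s)}
  have hbad : ∀ n, Q (bad n) ≤ ENNReal.ofReal (4 * d * 3 ^ d * (1 / (n : ℝ) ^ 2)) := by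
    intro n
    by_cases hn : N ≤ n
    swap
    · have : bad n = ∅ := by ext ω; simp [bad, hn]
      simp [this]
    obtain ⟨hmeas, hn1⟩ := hN n hn
    have hn0 : (0 : ℝ) < n := by exact_mod_cast hn1
    let S : Finset ((Fin d → ℤ) × (Fin d ⊕ Fin d)) :=
      (Fintype.piFinset fun _ : Fin d => Finset.Icc (-(n : ℤ)) n) ×ˢ Finset.univ
    have hcard : (S.card : ℝ) = (2 * n + 1) ^ d * (2 * d) := by
      have : (Finset.Icc (-(n : ℤ)) n).card = 2 * n + 1 := by
        rw [Int.card_Icc]; omega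
      simp only [S, Finset.card_product, Fintype.card_piFinset, this, Finset.prod_const,
        Finset.card_univ, Fintype.card_fin, Fintype.card_sum]
      push_cast; ring
    have hsub : bad n ⊆ ⋃ p ∈ S, {ω | (ω (bondAt p.1 p.2) : ℝ) ≤ (n : ℝ) ^ (-s)} := by
      rintro ω ⟨-, z, k, hz, hω⟩
      simp only [Set.mem_iUnion]
      exact ⟨(z, k), by simpa [S, Fintype.mem_piFinset, ← abs_le] using hz, hω⟩
    calc Q (bad n) ≤ ∑ p ∈ S, Q {ω | (ω (bondAt p.1 p.2) : ℝ) ≤ (n : ℝ) ^ (-s)} :=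
          (measure_mono hsub).trans (measure_biUnion_finset_le _ _)
      _ ≤ ∑ _p ∈ S, ENNReal.ofReal (2 * ((n : ℝ) ^ (-s)) ^ γ) :=
          Finset.sum_le_sum fun p _ => hmeas _
      _ = ENNReal.ofReal (S.card * (2 * ((n : ℝ) ^ (-s)) ^ γ)) := by
          rw [Finset.sum_const, nsmul_eq_mul, ENNReal.ofReal_mul (Nat.cast_nonneg _),
            ENNReal.ofReal_natCast]
      _ ≤ _ := by
          refine ENNReal.ofReal_le_ofReal ?_
          have h1 : ((n : ℝ) ^ (-s)) ^ γ ≤ 1 / ((n : ℝ) ^ d * (n : ℝ) ^ 2) := by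
            rw [← Real.rpow_mul hn0.le, one_div, ← pow_add, ← Real.rpow_natCast,
              ← Real.rpow_neg hn0.le]
            refine Real.rpow_le_rpow_of_exponent_le (by exact_mod_cast hn1) ?_
            push_cast
            linarith
          have h2 : (2 * (n : ℝ) + 1) ^ d ≤ (3 * n) ^ d := by
            have : (1 : ℝ) ≤ n := by exact_mod_cast hn1
            gcongr
            linarith
          rw [hcard]
          calc _ ≤ (3 * (n : ℝ)) ^ d * (2 * d) * (2 * (1 / ((n : ℝ) ^ d * (n : ℝ) ^ 2))) := by
                gcongr
            _ = _ := by rw [mul_pow]; field_simp; ring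
  have hsum : ∑' n, Q (bad n) ≠ ∞ := by
    refine ne_top_of_le_ne_top ?_ (ENNReal.tsum_le_tsum hbad)
    exact ((Real.summable_one_div_nat_pow.2 one_lt_two).mul_left _).tsum_ofReal_ne_top
  filter_upwards [ae_eventually_notMem hsum] with ω hω
  filter_upwards [hω, eventually_ge_atTop N] with n hn hNn z k hz
  by_contra hcon
  exact hn ⟨hNn, z, k, hz, not_lt.1 hcon⟩

/-! ### Asymptotics -/

/-- The bound of `heatKernel_le_of_elliptic` for `α = n^{-s}` and `r = ⌈n^κ⌉`: its first term is
of order `n^{2s - dκ}` and its second one decays faster than any power of `n`. -/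
theorem eventually_heatKernel_bound_le {d : ℕ} (hd : d ≠ 0) {s κ q : ℝ} (hκ : 0 < κ)
    (hsκ : 2 * κ + s < 1) (hq : q < d * κ - 2 * s) :
    ∀ᶠ n : ℕ in atTop, 4 * d * (4 * d / ((⌈(n : ℝ) ^ κ⌉₊ : ℝ) ^ d * ((n : ℝ) ^ (-s)) ^ 2) +
      Real.exp (-((n : ℝ) ^ (-s) / (4 * d ^ 3 * (⌈(n : ℝ) ^ κ⌉₊ : ℝ) ^ 2)) * (n / 2 : ℕ)) /
        (n : ℝ) ^ (-s)) ≤ (n : ℝ) ^ (-q) := by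
  have hd' : (0 : ℝ) < d := by positivity
  set θ := 1 - s - 2 * κ with hθ
  have hθ0 : 0 < θ := by linarith
  set c : ℝ := 1 / (64 * d ^ 3) with hc
  have hc0 : 0 < c := by positivity
  have hcast := tendsto_natCast_atTop_atTop (R := ℝ)
  have h1 : ∀ᶠ n : ℕ in atTop, 32 * (d : ℝ) ^ 2 ≤ (n : ℝ) ^ (d * κ - 2 * s - q) :=
    ((tendsto_rpow_atTop (by linarith)).comp hcast).eventually_ge_atTop _
  have h2 : ∀ᶠ n : ℕ in atTop,
      ((n : ℝ) ^ θ) ^ ((s + q) / θ) * Real.exp (-c * (n : ℝ) ^ θ) ≤ 1 / (8 * d) := by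
    have := ((tendsto_rpow_mul_exp_neg_mul_atTop_nhds_zero ((s + q) / θ) c hc0).comp
      ((tendsto_rpow_atTop hθ0).comp hcast)).eventually (ge_mem_nhds
        (by positivity : (0 : ℝ) < 1 / (8 * d)))
    exact this
  filter_upwards [h1, h2, eventually_ge_atTop 2] with n h1 h2 hn
  have hn2 : (2 : ℝ) ≤ n := by exact_mod_cast hn
  have hn0 : (0 : ℝ) < n := by linarith
  set r : ℝ := (⌈(n : ℝ) ^ κ⌉₊ : ℝ) with hr
  have hκ1 : 1 ≤ (n : ℝ) ^ κ := Real.one_le_rpow (by linarith) hκ.le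
  have hr1 : (n : ℝ) ^ κ ≤ r := Nat.le_ceil _
  have hr2 : r ≤ 2 * (n : ℝ) ^ κ := by
    have := Nat.ceil_lt_add_one (by positivity : 0 ≤ (n : ℝ) ^ κ)
    linarith
  have hr0 : 0 < r := by linarith
  have hhalf : (n : ℝ) / 4 ≤ (n / 2 : ℕ) := by
    have : (n : ℝ) ≤ 4 * (n / 2 : ℕ) := by exact_mod_cast (by omega : n ≤ 4 * (n / 2))
    linarith
  have hα : 0 < (n : ℝ) ^ (-s) := Real.rpow_pos_of_pos hn0 _
  have hq0 : 0 < (n : ℝ) ^ (-q) := Real.rpow_pos_of_pos hn0 _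
  have hA : 4 * d * (4 * d / (r ^ d * ((n : ℝ) ^ (-s)) ^ 2)) ≤ (n : ℝ) ^ (-q) / 2 := by
    have e1 : (n : ℝ) ^ (d * κ - 2 * s - q) * (n : ℝ) ^ q =
        ((n : ℝ) ^ κ) ^ d * ((n : ℝ) ^ (-s)) ^ 2 := by
      rw [← Real.rpow_natCast, ← Real.rpow_natCast, ← Real.rpow_mul hn0.le,
        ← Real.rpow_mul hn0.le, ← Real.rpow_add hn0, ← Real.rpow_add hn0]
      congr 1; push_cast; ring
    calc _ = 16 * (d : ℝ) ^ 2 / (r ^ d * ((n : ℝ) ^ (-s)) ^ 2) := by ring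
      _ ≤ 16 * (d : ℝ) ^ 2 / (((n : ℝ) ^ κ) ^ d * ((n : ℝ) ^ (-s)) ^ 2) := by gcongr
      _ ≤ 16 * (d : ℝ) ^ 2 / (32 * (d : ℝ) ^ 2 * (n : ℝ) ^ q) := by rw [← e1]; gcongr
      _ = _ := by rw [Real.rpow_neg hn0.le]; field_simp; norm_num
  have hB : 4 * d * (Real.exp (-((n : ℝ) ^ (-s) / (4 * d ^ 3 * r ^ 2)) * (n / 2 : ℕ)) /
      (n : ℝ) ^ (-s)) ≤ (n : ℝ) ^ (-q) / 2 := by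
    have e1 : c * (n : ℝ) ^ θ ≤ (n : ℝ) ^ (-s) / (4 * d ^ 3 * r ^ 2) * (n / 2 : ℕ) := by
      have e2 : (n : ℝ) ^ θ * ((n : ℝ) ^ κ) ^ 2 = (n : ℝ) ^ (-s) * n := by
        conv_rhs => rw [← Real.rpow_add_one hn0.ne']
        rw [← Real.rpow_natCast, ← Real.rpow_mul hn0.le, ← Real.rpow_add hn0]
        congr 1; push_cast; rw [hθ]; ring
      calc c * (n : ℝ) ^ θ
          = (n : ℝ) ^ θ * ((n : ℝ) ^ κ) ^ 2 / (64 * d ^ 3 * ((n : ℝ) ^ κ) ^ 2) := by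
            rw [hc]; field_simp
        _ = (n : ℝ) ^ (-s) / (4 * d ^ 3 * (2 * (n : ℝ) ^ κ) ^ 2) * (n / 4) := by
            rw [e2]; field_simp; norm_num
        _ ≤ _ := by gcongr
    have e3 : ((n : ℝ) ^ θ) ^ ((s + q) / θ) = (n : ℝ) ^ q / (n : ℝ) ^ (-s) := by
      rw [← Real.rpow_mul hn0.le, ← Real.rpow_sub hn0]
      congr 1; field_simp; ring
    rw [e3] at h2
    calc _ ≤ 4 * d * (Real.exp (-c * (n : ℝ) ^ θ) / (n : ℝ) ^ (-s)) := by
          rw [neg_mul, neg_mul]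
          gcongr
      _ = 4 * d * ((n : ℝ) ^ q / (n : ℝ) ^ (-s) * Real.exp (-c * (n : ℝ) ^ θ)) *
          (n : ℝ) ^ (-q) := by
          rw [Real.rpow_neg hn0.le q]; field_simp
      _ ≤ 4 * d * (1 / (8 * d)) * (n : ℝ) ^ (-q) := by gcongr
      _ = _ := by field_simp; norm_num
  rw [mul_add]
  linarith

/-! ### The almost sure bound -/

theorem log_div_log_le_of_le_rpow {n : ℕ} (hn : 2 ≤ n) {p : ℝ≥0∞} {q : ℝ}
    (hp : p ≤ ENNReal.ofReal ((n : ℝ) ^ q)) :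
    ENNReal.log p / ((Real.log n : ℝ) : EReal) ≤ (q : EReal) := by
  have hn1 : (1 : ℝ) < n := by exact_mod_cast hn
  have hlog : 0 < Real.log n := Real.log_pos hn1
  have hn0 : (0 : ℝ) < n := by linarith
  rw [EReal.div_le_iff_le_mul (by exact_mod_cast hlog) (EReal.coe_ne_top _)]
  refine (ENNReal.log_le_log hp).trans ?_
  rw [ENNReal.log_ofReal_of_pos (Real.rpow_pos_of_pos hn0 _), Real.log_rpow hn0, mul_comm]
  exact_mod_cast le_rfl

theorem heatKernel_le_of_lt_conductance {d n r : ℕ} (hd : d ≠ 0) (hr : r ≠ 0)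
    {ω : Environment d} {α : ℝ≥0} (hα : 0 < α) (hα1 : α ≤ 1) (hω1 : ∀ b, ω b ≤ 1)
    (hω : ∀ z k, (∀ i, |z i| ≤ (n : ℤ)) → α ≤ ω (bondAt z k)) (x : Fin d → ℤ) :
    heatKernel ω n 0 x ≤ ENNReal.ofReal (4 * d *
      (4 * d / (r ^ d * α ^ 2) + Real.exp (-(α / (4 * d ^ 3 * r ^ 2)) * (n / 2 : ℕ)) / α)) := by
  have h : heatKernel ω n 0 x = heatKernel (fun b => max (ω b) α) n 0 x := by
    refine heatKernel_congr (N := n) (fun z k hz => ?_) le_rfl x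
    exact (max_eq_left (hω z k (by simpa using hz))).symm
  rw [h]
  exact heatKernel_le_of_elliptic hd hr hα hα1 (fun b => le_max_right _ _)
    (fun b => max_le (hω1 b) hα1) n 0 x

theorem IsPolynomialTailLaw.ae_eventually_heatKernel_le {d : ℕ} (hd : 5 ≤ d) {γ : ℝ}
    (hγ : 8 * d < γ) {Q : Measure (Environment d)} [IsProbabilityMeasure Q]
    (hQ : IsPolynomialTailLaw γ Q) :
    ∀ᵐ ω ∂Q, ∀ᶠ n : ℕ in atTop, ∀ x,
      heatKernel ω n 0 x ≤ ENNReal.ofReal ((n : ℝ) ^ (-((d : ℝ) / 2) + 4 * (d : ℝ) ^ 2 / γ)) := by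
  have hd0 : d ≠ 0 := by omega
  have hd5 : (5 : ℝ) ≤ d := by exact_mod_cast hd
  have hγ0 : 0 < γ := by linarith
  have : Countable (Bond d) := inferInstance
  -- With `s = (d + 2) / γ` and `κ = 1 / 2 - 2 d / γ`, the exponent `2 s - d κ` is at most
  -- `-d / 2 + 4 d² / γ`, and the contraction rate `n^{-s - 2 κ}` beats `1 / n`.
  set s : ℝ := (d + 2) / γ with hs
  set κ : ℝ := 1 / 2 - 2 * d / γ with hκ
  have hs0 : 0 < s := by positivity
  have hsγ : (d : ℝ) + 2 ≤ s * γ := by rw [hs, div_mul_cancel₀ _ hγ0.ne']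
  have hκ0 : 0 < κ := by
    have : 2 * (d : ℝ) / γ < 1 / 2 := by rw [div_lt_iff₀ hγ0]; linarith
    linarith
  have hsκ : 2 * κ + s < 1 := by
    have : 2 * κ + s = 1 - (3 * d - 2) / γ := by rw [hκ, hs]; field_simp; ring
    have h2 : 0 < (3 * (d : ℝ) - 2) / γ := div_pos (by linarith) hγ0
    linarith
  have hq : (d : ℝ) / 2 - 4 * (d : ℝ) ^ 2 / γ < d * κ - 2 * s := by
    have : d * κ - 2 * s = (d : ℝ) / 2 - 4 * (d : ℝ) ^ 2 / γ +
        (2 * (d : ℝ) ^ 2 - 2 * d - 4) / γ := by rw [hκ, hs]; field_simp; ring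
    have h2 : 0 < (2 * (d : ℝ) ^ 2 - 2 * d - 4) / γ := div_pos (by nlinarith) hγ0
    linarith
  have hle : ∀ᵐ ω ∂Q, ∀ b, ω b ≤ 1 := ae_all_iff.2 hQ.le_one
  filter_upwards [hle, hQ.ae_eventually_lt hs0 hsγ] with ω hω1 hω
  filter_upwards [hω, eventually_heatKernel_bound_le hd0 hκ0 hsκ hq, eventually_ge_atTop 1]
    with n hn hbound hn1 x
  have hn0 : (0 : ℝ) < n := by exact_mod_cast hn1
  have hα : 0 < (n : ℝ) ^ (-s) := Real.rpow_pos_of_pos hn0 _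
  have hr : ⌈(n : ℝ) ^ κ⌉₊ ≠ 0 := (Nat.ceil_pos.2 (Real.rpow_pos_of_pos hn0 _)).ne'
  have hα1 : (n : ℝ) ^ (-s) ≤ 1 :=
    Real.rpow_le_one_of_one_le_of_nonpos (by exact_mod_cast hn1) (by linarith)
  refine (heatKernel_le_of_lt_conductance hd0 hr (α := ⟨(n : ℝ) ^ (-s), hα.le⟩) hα hα1 hω1
    (fun z k hz => (hn z k hz).le) x).trans (ENNReal.ofReal_le_ofReal ?_)
  rw [neg_sub] at hbound
  rw [neg_add_eq_sub]
  exact hbound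

/-- Logarithms of probabilities are `EReal`-valued, with `log 0 = ⊥`, so that the points `x` with
`P^n_ω(0, x) = 0` do not contribute to the supremum. -/
theorem theorem1p3 (d : ℕ) (hd : 5 ≤ d) :
    ∃ δ : ℝ → ℝ,
      (∀ γ : ℝ, 0 < γ → δ γ = 4 * (d : ℝ) ^ 2 / γ ∧ 0 < δ γ) ∧
      Tendsto δ atTop (𝓝 0) ∧
      ∀ γ : ℝ, 0 < γ →
        ∀ (Q : Measure (Environment d)) [IsProbabilityMeasure Q], IsPolynomialTailLaw γ Q →
          ∀ᵐ ω ∂Q,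
            limsup (fun n : ℕ => ⨆ x : Fin d → ℤ,
                ENNReal.log (heatKernel ω n 0 x) / ((Real.log n : ℝ) : EReal)) atTop
              ≤ ((-((d : ℝ) / 2) + δ γ : ℝ) : EReal) := by
  have hd0 : (0 : ℝ) < d := by exact_mod_cast (by omega : 0 < d)
  refine ⟨fun γ => 4 * (d : ℝ) ^ 2 / γ, fun γ hγ => ⟨rfl, by positivity⟩,
    tendsto_const_nhds.div_atTop tendsto_id, fun γ hγ Q _ hQ => ?_⟩
  suffices h : ∀ᵐ ω ∂Q, ∀ᶠ n : ℕ in atTop, ∀ x, heatKernel ω n 0 x ≤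
      ENNReal.ofReal ((n : ℝ) ^ (-((d : ℝ) / 2) + 4 * (d : ℝ) ^ 2 / γ)) by
    filter_upwards [h] with ω hω
    refine limsup_le_of_le (h := ?_)
    filter_upwards [hω, eventually_ge_atTop 2] with n hn hn2
    exact iSup_le fun x => log_div_log_le_of_le_rpow hn2 (hn x)
  rcases lt_or_ge (8 * (d : ℝ)) γ with h8 | h8
  · exact hQ.ae_eventually_heatKernel_le hd h8
  -- For `γ ≤ 8 d` the exponent is nonnegative, and probabilities are at most `1`.
  · refine Eventually.of_forall fun ω => ?_
    filter_upwards [eventually_ge_atTop 1] with n hn x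
    refine (heatKernel_le_one ω n 0 x).trans ?_
    rw [ENNReal.one_le_ofReal]
    refine Real.one_le_rpow (by exact_mod_cast hn) ?_
    have : (d : ℝ) / 2 ≤ 4 * (d : ℝ) ^ 2 / γ := by
      rw [le_div_iff₀ hγ]
      nlinarith
    linarith
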